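/- **Conventions.** For families of subsets of a set $X$, $\mathcal U$ *refines* $\mathcal V$ if each member of $\mathcal U$ lies in a member of $\mathcal V$. A *pre-uniformity* on $X$ is a filter of covers of $X$: a collection of covers that contains $\{X\}$, contains every cover refined by one of its members, and contains $\{U\cap V: U\in\mathcal U, V\in\mathcal V\}$ whenever it contains $\mathcal U$ and $\mathcal V$. A uniformity is identified with the pre-uniformity of its uniform covers. For pre-uniformities $\mu,\nu$, let $\mu/\nu$ be the pre-uniformity generated by the covers $\{U\cap V: U\in\mathcal U,\ V\in\mathcal V_U\}$ with $\mathcal U\in\mu$ and $\mathcal V_U\in\nu$ for every $U\in\mathcal U$. The *locally fine coreflection* $\lambda\mu$ is the smallest pre-uniformity $\nu$ containing $\mu$ such that $\nu/\nu\subseteq\nu$. A uniform space is *supercomplete* if the hyperspace of its closed subsets, with the Hausdorff uniformity, is complete. The *fine uniformity* of a uniformizable topological space is the finest uniformity inducing its topology. A cover $\mathcal U$ of a topological space $X$ (by arbitrary subsets) is *exhaustive* if every non-empty $S\subseteq X$ has a non-empty relatively open subset of the form $U\cap S$ with $U\in\mathcal U$. A sequence $(\mathcal U_n)$ of covers is *complete*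 if every proper filter that contains a member of $\mathcal U_n$ for each $n$ has a cluster point. $X$ is *partition-complete* if it has a complete sequence of exhaustive covers. **Corollary 6.3.** Let $(\mu_iX_i)_{i\in I}$ be a countable family of supercomplete uniform spaces whose underlying topological spaces $X_i$ are partition-complete. Then the product uniform space $\prod_i\mu_iX_i$ is supercomplete. Moreover, every open cover of $\prod_i X_i$ belongs to $\lambda\prod_i\mu_i$, and $\lambda\prod_i\mu_i$ equals the fine uniformity of $\prod_i X_i$. -/

import Mathlib

namespace Supercompleteness

open Set

/-- `𝒰` refines `𝒱`: every member of `𝒰` is contained in a member of `𝒱`. -/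
def Refines {X : Type*} (𝒰 𝒱 : Set (Set X)) : Prop :=
  ∀ U ∈ 𝒰, ∃ V ∈ 𝒱, U ⊆ V

/-- A pre-uniformity on a set: a filter of covers with respect to refinement. -/
@[ext]
structure PreUniformity (X : Type*) where
  covers : Set (Set (Set X))
  sUnion_eq : ∀ 𝒰 ∈ covers, ⋃₀ 𝒰 = univ
  univ_mem : {univ} ∈ covers
  mem_of_refines : ∀ 𝒰 ∈ covers, ∀ 𝒱, Refines 𝒰 𝒱 → 𝒱 ∈ covers
  inter_mem : ∀ 𝒰 ∈ covers, ∀ 𝒱 ∈ covers, {W | ∃ U ∈ 𝒰, ∃ V ∈ 𝒱, W = U ∩ V} ∈ covers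

/-- The uniform covers of a uniform space: those refined by the cover by the balls of
some entourage. -/
def uniformCovers {X : Type*} (u : UniformSpace X) : PreUniformity X where
  covers := {𝒰 | ∃ E ∈ u.uniformity, ∀ x, ∃ U ∈ 𝒰, UniformSpace.ball x E ⊆ U}
  sUnion_eq := by
    rintro 𝒰 ⟨E, hE, h⟩
    refine eq_univ_of_forall fun x => ?_
    obtain ⟨U, hU, hx⟩ := h x
    exact ⟨U, hU, hx (UniformSpace.mem_ball_self x hE)⟩
  univ_mem := ⟨univ, Filter.univ_mem, fun _ => ⟨univ, rfl, subset_univ _⟩⟩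
  mem_of_refines := by
    rintro 𝒰 ⟨E, hE, h⟩ 𝒱 hr
    refine ⟨E, hE, fun x => ?_⟩
    obtain ⟨U, hU, hx⟩ := h x
    obtain ⟨V, hV, hUV⟩ := hr U hU
    exact ⟨V, hV, hx.trans hUV⟩
  inter_mem := by
    rintro 𝒰 ⟨E, hE, h⟩ 𝒱 ⟨F, hF, k⟩
    refine ⟨E ∩ F, Filter.inter_mem hE hF, fun x => ?_⟩
    obtain ⟨U, hU, hx⟩ := h x
    obtain ⟨V, hV, hy⟩ := k x
    exact ⟨U ∩ V, ⟨U, hU, V, hV, rfl⟩, fun y hy' => ⟨hx hy'.1, hy hy'.2⟩⟩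

/-- The pre-uniformity `μ / ν` generated by the covers `{U ∩ V : U ∈ 𝒰, V ∈ 𝒱 U}`,
where `𝒰 ∈ μ` and `𝒱 U ∈ ν` for every `U ∈ 𝒰`. -/
def PreUniformity.div {X : Type*} (μ ν : PreUniformity X) : PreUniformity X where
  covers := {𝒲 | ∃ 𝒰 ∈ μ.covers, ∃ 𝒱 : Set X → Set (Set X), (∀ U ∈ 𝒰, 𝒱 U ∈ ν.covers) ∧
    Refines {W | ∃ U ∈ 𝒰, ∃ V ∈ 𝒱 U, W = U ∩ V} 𝒲}
  sUnion_eq := by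
    rintro 𝒲 ⟨𝒰, h𝒰, 𝒱, h𝒱, hr⟩
    refine eq_univ_of_forall fun x => ?_
    obtain ⟨U, hU, hxU⟩ : x ∈ ⋃₀ 𝒰 := by rw [μ.sUnion_eq 𝒰 h𝒰]; trivial
    obtain ⟨V, hV, hxV⟩ : x ∈ ⋃₀ 𝒱 U := by rw [ν.sUnion_eq _ (h𝒱 U hU)]; trivial
    obtain ⟨W, hW, hs⟩ := hr _ ⟨U, hU, V, hV, rfl⟩
    exact ⟨W, hW, hs ⟨hxU, hxV⟩⟩
  univ_mem := ⟨{univ}, μ.univ_mem, fun _ => {univ}, fun _ _ => ν.univ_mem,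
    fun _ _ => ⟨univ, rfl, subset_univ _⟩⟩
  mem_of_refines := by
    rintro 𝒲 ⟨𝒰, h𝒰, 𝒱, h𝒱, hr⟩ 𝒲' hr'
    refine ⟨𝒰, h𝒰, 𝒱, h𝒱, fun A hA => ?_⟩
    obtain ⟨W, hW, hs⟩ := hr A hA
    obtain ⟨W', hW', hs'⟩ := hr' W hW
    exact ⟨W', hW', hs.trans hs'⟩
  inter_mem := by
    rintro 𝒲 ⟨𝒰, h𝒰, 𝒱, h𝒱, hr⟩ 𝒲' ⟨𝒰', h𝒰', 𝒱', h𝒱', hr'⟩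
    have key : ∀ A, ∃ 𝒬 : Set (Set X),
        (∃ U ∈ 𝒰, ∃ U' ∈ 𝒰', A = U ∩ U') → 𝒬 ∈ ν.covers ∧
          ∀ Q ∈ 𝒬, ∃ W ∈ 𝒲, ∃ W' ∈ 𝒲', A ∩ Q ⊆ W ∩ W' := by
      intro A
      by_cases hA : ∃ U ∈ 𝒰, ∃ U' ∈ 𝒰', A = U ∩ U'
      · obtain ⟨U, hU, U', hU', rfl⟩ := hA
        refine ⟨_, fun _ => ⟨ν.inter_mem _ (h𝒱 U hU) _ (h𝒱' U' hU'), ?_⟩⟩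
        rintro Q ⟨V, hV, V', hV', rfl⟩
        obtain ⟨W, hW, hs⟩ := hr _ ⟨U, hU, V, hV, rfl⟩
        obtain ⟨W', hW', hs'⟩ := hr' _ ⟨U', hU', V', hV', rfl⟩
        exact ⟨W, hW, W', hW', fun x hx => ⟨hs ⟨hx.1.1, hx.2.1⟩, hs' ⟨hx.1.2, hx.2.2⟩⟩⟩
      · exact ⟨∅, fun h => absurd h hA⟩
    choose 𝒬 h𝒬 using key
    refine ⟨_, μ.inter_mem 𝒰 h𝒰 𝒰' h𝒰', 𝒬, fun A hA => (h𝒬 A hA).1, ?_⟩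
    rintro B ⟨A, hA, Q, hQ, rfl⟩
    obtain ⟨W, hW, W', hW', hs⟩ := (h𝒬 A hA).2 Q hQ
    exact ⟨W ∩ W', ⟨W, hW, W', hW', rfl⟩, hs⟩

/-- The pre-uniformity of all covers. -/
def allCovers (X : Type*) : PreUniformity X where
  covers := {𝒰 | ⋃₀ 𝒰 = univ}
  sUnion_eq _ h := h
  univ_mem := sUnion_singleton _
  mem_of_refines := by
    intro 𝒰 h 𝒱 hr
    refine eq_univ_of_forall fun x => ?_
    obtain ⟨U, hU, hx⟩ : x ∈ ⋃₀ 𝒰 := h ▸ mem_univ x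
    obtain ⟨V, hV, hs⟩ := hr U hU
    exact ⟨V, hV, hs hx⟩
  inter_mem := by
    intro 𝒰 h 𝒱 k
    refine eq_univ_of_forall fun x => ?_
    obtain ⟨U, hU, hx⟩ : x ∈ ⋃₀ 𝒰 := h ▸ mem_univ x
    obtain ⟨V, hV, hy⟩ : x ∈ ⋃₀ 𝒱 := k ▸ mem_univ x
    exact ⟨U ∩ V, ⟨U, hU, V, hV, rfl⟩, hx, hy⟩

/-- The locally fine coreflection `λμ`: the smallest pre-uniformity `ν` that contains `μ` and
is closed under the operation `ν ↦ ν / ν`. -/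
def PreUniformity.locallyFine {X : Type*} (μ : PreUniformity X) : PreUniformity X where
  covers := {𝒰 | ∀ ν : PreUniformity X, μ.covers ⊆ ν.covers →
    (ν.div ν).covers ⊆ ν.covers → 𝒰 ∈ ν.covers}
  sUnion_eq _ h := h (allCovers X) μ.sUnion_eq ((allCovers X).div (allCovers X)).sUnion_eq
  univ_mem ν _ _ := ν.univ_mem
  mem_of_refines 𝒰 h 𝒱 hr ν h₁ h₂ := ν.mem_of_refines 𝒰 (h ν h₁ h₂) 𝒱 hr
  inter_mem 𝒰 h 𝒱 k ν h₁ h₂ := ν.inter_mem 𝒰 (h ν h₁ h₂) 𝒱 (k ν h₁ h₂)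

/-- The fine uniformity of a (uniformizable) topological space: the finest uniformity that
induces the topology. In Mathlib's order finer uniformities are smaller. -/
@[reducible]
def fineUniformity (X : Type*) [t : TopologicalSpace X] : UniformSpace X :=
  sInf {u : UniformSpace X | u.toTopologicalSpace = t}

/-- A uniform space is supercomplete if the hyperspace of its closed subsets is complete in the
Hausdorff uniformity. (The empty set is an isolated point of the hyperspace, so it does not
matter whether it is included.) -/
def Supercomplete (X : Type*) [UniformSpace X] : Prop :=
  CompleteSpace (TopologicalSpace.Closeds X)

/-- An exhaustive cover: every non-empty subset `S` has a non-empty relatively open subset of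
the form `U ∩ S` with `U` in the cover. -/
def IsExhaustiveCover {X : Type*} [TopologicalSpace X] (𝒰 : Set (Set X)) : Prop :=
  ⋃₀ 𝒰 = univ ∧ ∀ S : Set X, S.Nonempty →
    ∃ U ∈ 𝒰, (U ∩ S).Nonempty ∧ ∃ G : Set X, IsOpen G ∧ U ∩ S = G ∩ S

/-- A sequence of covers is complete if every (proper) filter that contains, for each `n`, a
member of the `n`-th cover has a cluster point. -/
def IsCompleteSequence {X : Type*} [TopologicalSpace X] (𝒰 : ℕ → Set (Set X)) : Prop :=
  ∀ F : Filter X, F.NeBot → (∀ n, ∃ U ∈ 𝒰 n, U ∈ F) → ∃ x, ClusterPt x F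

/-- A space is partition-complete if it has a complete sequence of exhaustive covers. -/
def PartitionComplete (X : Type*) [TopologicalSpace X] : Prop :=
  ∃ 𝒰 : ℕ → Set (Set X), (∀ n, IsExhaustiveCover (𝒰 n)) ∧ IsCompleteSequence 𝒰

end Supercompleteness

namespace Supercompleteness

open Set Filter Topology Uniformity UniformSpace

/-! A space is supercomplete exactly when each open cover reaches the trivial situation "contained
in one member" by a well-founded tree of uniform refinements; `LocallyFineOn` records such trees.
`Supercomplete.locallyFineOn_univ` and `supercomplete_of_locallyFineOn` give the two directions, so
the matter is to build these trees on the product.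

Call a set bad if the open cover `𝒢` of the product is not locally fine on it, and suppose the whole
product is bad. A bad `A` has in each factor a closed non-empty residual set, where the badness
concentrates: cutting `A` by the preimage of an open neighbourhood of that set leaves it bad.
Exhaustive covers allow `A` to shrink until a residual set fits in a prescribed cover. Running
through the countably many pairs (factor, cover) gives decreasing bad sets whose residual sets
shrink, by completeness, to non-empty compact sets `K i`. By Lebesgue's lemma `𝒢` is locally fine on
a uniform neighbourhood of the compact product of the `K i`. Since that neighbourhood restricts
finitely many coordinates, finitely many cuts put a bad set inside it, a contradiction
(`locallyFineOn_univ_pi`).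

The same trees produce locally finite open refinements. The product is thus paracompact, and its
fine uniform covers are those refined by open covers. -/

/-- `LocallyFineOn 𝒢 A`: the trace of `𝒢` on `A` is obtained from uniform covers by iterated
(well-founded) refinement. -/
inductive LocallyFineOn {X : Type*} [UniformSpace X] (𝒢 : Set (Set X)) : Set X → Prop
  | of_subset {A G : Set X} : G ∈ 𝒢 → A ⊆ G → LocallyFineOn 𝒢 A
  | of_ball {A : Set X} {E : Set (X × X)} : E ∈ 𝓤 X →
      (∀ x, LocallyFineOn 𝒢 (A ∩ ball x E)) → LocallyFineOn 𝒢 A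

/-! ### Refinement trees and supercompleteness -/

section

variable {X : Type*} [UniformSpace X] {𝒢 : Set (Set X)} {A B : Set X}

theorem LocallyFineOn.mono (h : LocallyFineOn 𝒢 A) (hBA : B ⊆ A) : LocallyFineOn 𝒢 B := by
  induction h generalizing B with
  | of_subset hG hA => exact .of_subset hG (hBA.trans hA)
  | of_ball hE _ ih => exact .of_ball hE fun x => ih x (inter_subset_inter_left _ hBA)

theorem locallyFineOn_empty (h𝒢 : ⋃₀ 𝒢 = univ) : LocallyFineOn 𝒢 ∅ := by
  -- If `X` is empty, `𝒢` may have no member, but the ball rule holds vacuously.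
  rcases isEmpty_or_nonempty X with hX | ⟨⟨x⟩⟩
  · exact .of_ball univ_mem fun x => hX.elim x
  · obtain ⟨G, hG, -⟩ : x ∈ ⋃₀ 𝒢 := h𝒢 ▸ mem_univ x
    exact .of_subset hG (empty_subset _)

theorem LocallyFineOn.mem_covers (ν : PreUniformity X)
    (hμ : (uniformCovers ‹UniformSpace X›).covers ⊆ ν.covers)
    (hν : (ν.div ν).covers ⊆ ν.covers) (h : LocallyFineOn 𝒢 A) :
    {V | ∃ G ∈ 𝒢, A ∩ V ⊆ G} ∈ ν.covers := by
  induction h with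
  | of_subset hG hA =>
    refine ν.mem_of_refines _ ν.univ_mem _ ?_
    rintro _ rfl
    exact ⟨univ, ⟨_, hG, inter_subset_left.trans hA⟩, subset_rfl⟩
  | @of_ball A E hE _ ih =>
    apply hν
    refine ⟨range fun x => ball x E, hμ ⟨E, hE, fun x => ⟨_, mem_range_self x, subset_rfl⟩⟩,
      fun U => {V | ∃ G ∈ 𝒢, A ∩ U ∩ V ⊆ G}, ?_, ?_⟩
    · rintro _ ⟨x, rfl⟩
      exact ih x
    · rintro _ ⟨_, ⟨x, rfl⟩, V, ⟨G, hG, hV⟩, rfl⟩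
      exact ⟨_, ⟨G, hG, by rwa [← inter_assoc]⟩, subset_rfl⟩

theorem LocallyFineOn.mem_locallyFine (h : LocallyFineOn 𝒢 univ) :
    𝒢 ∈ (uniformCovers ‹UniformSpace X›).locallyFine.covers := by
  intro ν hμ hν
  refine ν.mem_of_refines _ (h.mem_covers ν hμ hν) _ ?_
  rintro V ⟨G, hG, hV⟩
  exact ⟨G, hG, by simpa using hV⟩

/-- Trees can be grafted: the tree on `X` pulls back along `f`, and each of its leaves is continued
by a tree for `ℋ`. -/
theorem LocallyFineOn.inter_preimage {Y : Type*} [UniformSpace Y] {f : Y → X}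
    (hf : UniformContinuous f) {𝒪 : Set (Set X)} {ℋ : Set (Set Y)} {C : Set Y}
    (h : LocallyFineOn 𝒪 B) (h𝒪 : ∀ O ∈ 𝒪, LocallyFineOn ℋ (C ∩ f ⁻¹' O)) :
    LocallyFineOn ℋ (C ∩ f ⁻¹' B) := by
  induction h with
  | of_subset hO hB => exact (h𝒪 _ hO).mono (inter_subset_inter_right _ (preimage_mono hB))
  | of_ball hE _ ih =>
    refine .of_ball (hf hE) fun y => (ih (f y)).mono ?_
    rintro z ⟨⟨hz, hzB⟩, hzE⟩
    exact ⟨hz, hzB, hzE⟩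

/-- In a supercomplete space every open cover is locally fine. -/
theorem Supercomplete.locallyFineOn_univ (hX : Supercomplete X) (hopen : ∀ G ∈ 𝒢, IsOpen G)
    (hcover : ⋃₀ 𝒢 = univ) : LocallyFineOn 𝒢 univ := by
  by_contra hbad
  let H : Set (X × X) → Set X := fun E => {x | ¬ LocallyFineOn 𝒢 (ball x E)}
  let c : Set (X × X) → TopologicalSpace.Closeds X := fun E => ⟨closure (H E), isClosed_closure⟩
  -- Entourages tending to the diagonal. The principal part discards small sets that are not
  -- entourages.
  let L : Filter (Set (X × X)) := (𝓤 X).smallSets ⊓ 𝓟 (𝓤 X).sets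
  have hL : L.HasBasis (fun E => E ∈ 𝓤 X) (fun E => {F | F ⊆ E} ∩ (𝓤 X).sets) :=
    (𝓤 X).basis_sets.smallSets.inf_principal _
  have : L.NeBot := hL.neBot_iff.2 fun {E} hE => ⟨E, fun _ h => h, hE⟩
  have hne : ∀ E ∈ 𝓤 X, (H E).Nonempty := by
    intro E hE
    by_contra hemp
    rw [not_nonempty_iff_eq_empty, eq_empty_iff_forall_notMem] at hemp
    exact hbad (.of_ball hE fun x => (not_not.1 (hemp x)).mono inter_subset_right)
  have key : ∀ D ∈ 𝓤 X, ∃ D' ∈ 𝓤 X, ∀ E ∈ 𝓤 X, ∀ F ∈ 𝓤 X, E ⊆ D' → F ⊆ D' →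
      ∀ x ∈ closure (H E), ∃ y ∈ closure (H F), (x, y) ∈ D ∧ (y, x) ∈ D := by
    intro D hD
    obtain ⟨D₁, hD₁, hs₁, hc₁⟩ := comp_symm_of_uniformity hD
    obtain ⟨D₂, hD₂, hs₂, hc₂⟩ := comp_symm_of_uniformity hD₁
    refine ⟨D₂, hD₂, fun E hE F hF hED hFD x hx => ?_⟩
    obtain ⟨x', hxx', hx'⟩ := UniformSpace.mem_closure_iff_ball.1 hx hD₂
    -- The bad ball at `x'` has a bad trace on some `F`-ball. Its centre lies in `H F`, and it is
    -- near `x'` because the trace is non-empty.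
    obtain ⟨y, hy⟩ : ∃ y, ¬ LocallyFineOn 𝒢 (ball x' E ∩ ball y F) := by
      by_contra! hall
      exact hx' (.of_ball hF hall)
    obtain ⟨z, hzE, hzF⟩ : (ball x' E ∩ ball y F).Nonempty := by
      rw [nonempty_iff_ne_empty]
      intro h0
      exact hy (h0 ▸ locallyFineOn_empty hcover)
    have h₁ : (x', y) ∈ D₁ := hc₂ ⟨z, hED hzE, hs₂ (hFD hzF)⟩
    have h₂ : (x, x') ∈ D₁ := hc₂ ⟨x', hxx', refl_mem_uniformity hD₂⟩
    exact ⟨y, subset_closure fun h => hy (h.mono inter_subset_right), hc₁ ⟨x', h₂, h₁⟩,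
      hc₁ ⟨x', hs₁ h₁, hs₁ h₂⟩⟩
  have hcauchy : Cauchy (map c L) := by
    refine cauchy_iff.2 ⟨inferInstance, fun s hs => ?_⟩
    obtain ⟨D, hD, hDs⟩ := (𝓤 X).basis_sets.uniformity_closeds.mem_iff.1 hs
    obtain ⟨D', hD', h⟩ := key D hD
    refine ⟨_, image_mem_map (hL.mem_of_mem hD'), ?_⟩
    rintro ⟨_, _⟩ ⟨⟨E, ⟨hE, hE'⟩, rfl⟩, ⟨F, ⟨hF, hF'⟩, rfl⟩⟩
    refine hDs ⟨fun x hx => ?_, fun x hx => ?_⟩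
    · obtain ⟨y, hy, hxy, -⟩ := h E hE' F hF' hE hF x hx
      exact ⟨y, hy, hxy⟩
    · obtain ⟨y, hy, -, hyx⟩ := h F hF' E hE' hF hE x hx
      exact ⟨y, hy, hyx⟩
  obtain ⟨C, hC⟩ := hX.complete hcauchy
  have hlim : ∀ D ∈ 𝓤 X, ∀ D' ∈ 𝓤 X, ∃ E ∈ 𝓤 X, E ⊆ D' ∧
      (∀ x ∈ C, ∃ y ∈ closure (H E), (x, y) ∈ D) ∧ ∀ y ∈ closure (H E), ∃ x ∈ C, (x, y) ∈ D := by
    intro D hD D' hD'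
    have h₁ := hC (UniformSpace.ball_mem_nhds C ((𝓤 X).basis_sets.uniformity_closeds.mem_of_mem hD))
    obtain ⟨E, hE, hE', hE''⟩ := Filter.nonempty_of_mem (inter_mem (mem_map.1 h₁) (hL.mem_of_mem hD'))
    exact ⟨E, hE'', hE', hE.1, hE.2⟩
  obtain ⟨z, hz⟩ : ∃ z, z ∈ C := by
    obtain ⟨E, hE, -, -, h⟩ := hlim univ univ_mem univ univ_mem
    obtain ⟨y, hy⟩ := hne E hE
    obtain ⟨x, hx, -⟩ := h y (subset_closure hy)
    exact ⟨x, hx⟩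
  obtain ⟨G, hG, hzG⟩ : z ∈ ⋃₀ 𝒢 := hcover ▸ mem_univ z
  obtain ⟨D, hD, hDG⟩ := UniformSpace.mem_nhds_iff.1 ((hopen G hG).mem_nhds hzG)
  obtain ⟨D₁, hD₁, -, hc₁⟩ := comp_symm_of_uniformity hD
  obtain ⟨D₂, hD₂, -, hc₂⟩ := comp_symm_of_uniformity hD₁
  obtain ⟨E, hE, hED, h, -⟩ := hlim D₂ hD₂ D₁ hD₁
  obtain ⟨y, hy, hzy⟩ := h z hz
  obtain ⟨w, hyw, hw⟩ := UniformSpace.mem_closure_iff_ball.1 hy hD₂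
  refine hw (.of_subset hG fun v hv => hDG (hc₁ ⟨w, hc₂ ⟨y, hzy, hyw⟩, hED hv⟩))

/-- A uniform space all of whose open covers are locally fine is supercomplete. -/
theorem supercomplete_of_locallyFineOn
    (hX : ∀ 𝒢 : Set (Set X), (∀ G ∈ 𝒢, IsOpen G) → ⋃₀ 𝒢 = univ → LocallyFineOn 𝒢 univ) :
    Supercomplete X := by
  refine ⟨fun {f} hf => ?_⟩
  have := hf.1
  have hfD : ∀ D ∈ 𝓤 X, ∃ 𝒞 ∈ f, ∀ C ∈ 𝒞, ∀ C' ∈ 𝒞, ∀ x ∈ C, ∃ y ∈ C', (x, y) ∈ D := by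
    intro D hD
    obtain ⟨𝒞, h𝒞, h⟩ := (cauchy_iff.1 hf).2 _
      ((𝓤 X).basis_sets.uniformity_closeds.mem_of_mem hD)
    exact ⟨𝒞, h𝒞, fun C hC C' hC' x hx => (h (mk_mem_prod hC hC')).1 hx⟩
  -- The candidate limit: points that the sets of `f` eventually approach arbitrarily closely.
  let K : Set X := {z | ∀ D ∈ 𝓤 X, ∀ᶠ C in f, ∃ x ∈ C, (z, x) ∈ D}
  have hKclosed : IsClosed K := by
    refine isClosed_of_closure_subset fun z hz D hD => ?_
    obtain ⟨D₁, hD₁, -, hc₁⟩ := comp_symm_of_uniformity hD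
    obtain ⟨z', hzz', hz'⟩ := UniformSpace.mem_closure_iff_ball.1 hz hD₁
    filter_upwards [hz' D₁ hD₁] with C ⟨x, hx, hx'⟩
    exact ⟨x, hx, hc₁ ⟨z', hzz', hx'⟩⟩
  have hK : ∀ z ∉ K, ∃ D ∈ 𝓤 X, ∀ᶠ C in f, ∀ x ∈ C, (z, x) ∉ D := by
    intro z hz
    simp only [K, mem_ofPred_eq, not_forall] at hz
    obtain ⟨D, hD, hz⟩ := hz
    obtain ⟨D₁, hD₁, -, hc₁⟩ := comp_symm_of_uniformity hD
    obtain ⟨𝒞, h𝒞, h⟩ := hfD D₁ hD₁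
    refine ⟨D₁, hD₁, ?_⟩
    filter_upwards [h𝒞] with C hC x hx hzx
    apply hz
    filter_upwards [h𝒞] with C' hC'
    obtain ⟨y, hy, hxy⟩ := h C hC C' hC' x hx
    exact ⟨y, hy, hc₁ ⟨x, hzx, hxy⟩⟩
  refine ⟨⟨K, hKclosed⟩, (nhds_basis_uniformity'
    (𝓤 X).basis_sets.uniformity_closeds).ge_iff.2 fun D hD => ?_⟩
  obtain ⟨D₁, hD₁, hs₁, hc₁⟩ := comp_symm_of_uniformity hD
  let 𝒢 : Set (Set X) :=
    {O | IsOpen O ∧ ((∀ᶠ C in f, ∀ x ∈ C, x ∉ O) ∨ ∃ z ∈ K, O ⊆ ball z D₁)}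
  have h𝒢 : LocallyFineOn 𝒢 univ := by
    refine hX 𝒢 (fun G hG => hG.1) (eq_univ_of_forall fun z => ?_)
    by_cases hz : z ∈ K
    · exact ⟨interior (ball z D₁), ⟨isOpen_interior, Or.inr ⟨z, hz, interior_subset⟩⟩,
        mem_interior_iff_mem_nhds.2 (UniformSpace.ball_mem_nhds z hD₁)⟩
    · obtain ⟨D', hD', h⟩ := hK z hz
      refine ⟨interior (ball z D'), ⟨isOpen_interior, Or.inl ?_⟩,
        mem_interior_iff_mem_nhds.2 (UniformSpace.ball_mem_nhds z hD')⟩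
      filter_upwards [h] with C hC x hx hxi
      exact hC x hx ((interior_subset : interior (ball z D') ⊆ ball z D') hxi)
  -- The margin `F` lets the induction pass from `B` to a small ball about `b ∈ B`: if members of
  -- `f` eventually miss that ball, no member close to them contains `b`.
  have step : ∀ A, LocallyFineOn 𝒢 A → ∀ B : Set X, ∀ F ∈ 𝓤 X,
      (∀ b ∈ B, ball b F ⊆ A ∩ {x | ∀ z ∈ K, (z, x) ∉ D₁}) → ∀ᶠ C in f, ∀ x ∈ C, x ∉ B := by
    intro A hA
    induction hA with
    | @of_subset A O hO hAO =>
      intro B F hF hB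
      rcases hO.2 with h | ⟨z, hz, h⟩
      · filter_upwards [h] with C hC x hx hxB
        exact hC x hx (hAO (hB x hxB (refl_mem_uniformity hF)).1)
      · refine Eventually.of_forall fun C x hx hxB => ?_
        have := hB x hxB (refl_mem_uniformity hF)
        exact this.2 z hz (h (hAO this.1))
    | @of_ball A E hE _ ih =>
      intro B F hF hB
      obtain ⟨M, hM, -, hMc⟩ := comp_symm_of_uniformity (inter_mem hE hF)
      obtain ⟨𝒞, h𝒞, h⟩ := hfD M hM
      filter_upwards [h𝒞] with C hC b hb hbB
      have hmiss := ih b (ball b M) M hM fun y hy w hw => by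
        have hbw : (b, w) ∈ E ∩ F := hMc ⟨y, hy, hw⟩
        exact ⟨⟨(hB b hbB hbw.2).1, hbw.1⟩, (hB b hbB hbw.2).2⟩
      obtain ⟨C', hC', hC''⟩ := (hmiss.and h𝒞).exists
      obtain ⟨y, hy, hby⟩ := h C hC C' hC'' b hb
      exact hC' y hy hby
  obtain ⟨𝒞, h𝒞, h⟩ := hfD D₁ hD₁
  filter_upwards [h𝒞, step univ h𝒢 {x | ∀ z ∈ K, (z, x) ∉ D} D₁ hD₁ fun b hb y hy =>
    ⟨trivial, fun z hz hzy => hb z hz (hc₁ ⟨y, hzy, hs₁ hy⟩)⟩] with C hC hC'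
  refine ⟨fun z hz => ?_, fun x hx => ?_⟩
  · obtain ⟨C', ⟨x, hx, hzx⟩, hC'⟩ := ((hz D₁ hD₁).and h𝒞).exists
    obtain ⟨y, hy, hxy⟩ := h C' hC' C hC x hx
    exact ⟨y, hy, hc₁ ⟨x, hzx, hxy⟩⟩
  · by_contra hcon
    exact hC' x hx fun z hz hzx => hcon ⟨z, hz, hzx⟩

end

/-! ### Residual sets -/

/-- The points all of whose open neighbourhoods `O` have a trace `A ∩ f ⁻¹' O` on which `𝒢` is not
locally fine. -/
def residualSet {X Y : Type*} [TopologicalSpace X] [UniformSpace Y] (f : Y → X)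
    (𝒢 : Set (Set Y)) (A : Set Y) : Set X :=
  {x | ∀ O, IsOpen O → x ∈ O → ¬ LocallyFineOn 𝒢 (A ∩ f ⁻¹' O)}

section

variable {X Y : Type*} [UniformSpace X] [UniformSpace Y] {f : Y → X} {𝒢 : Set (Set Y)}
  {A B : Set Y}

theorem residualSet_mono (hAB : A ⊆ B) : residualSet f 𝒢 A ⊆ residualSet f 𝒢 B :=
  fun _ hx O hO hxO h => hx O hO hxO (h.mono (inter_subset_inter_left _ hAB))

theorem isClosed_residualSet : IsClosed (residualSet f 𝒢 A) := by
  rw [← isOpen_compl_iff, isOpen_iff_forall_mem_open]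
  intro x hx
  simp only [residualSet, mem_compl_iff, mem_ofPred_eq, not_forall, not_not] at hx
  obtain ⟨O, hO, hxO, h⟩ := hx
  exact ⟨O, fun y hy hy' => hy' O hO hy h, hO, hxO⟩

variable (hX : ∀ 𝒪 : Set (Set X), (∀ O ∈ 𝒪, IsOpen O) → ⋃₀ 𝒪 = univ → LocallyFineOn 𝒪 univ)
  (hf : UniformContinuous f)

include hX hf

/-- Otherwise `N` and the open sets with good trace would cover `X`, and grafting along `f` would
make `A` good. -/
theorem not_locallyFineOn_inter_preimage (hA : ¬ LocallyFineOn 𝒢 A) {N : Set X} (hN : IsOpen N)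
    (hAN : residualSet f 𝒢 A ⊆ N) : ¬ LocallyFineOn 𝒢 (A ∩ f ⁻¹' N) := by
  intro h
  apply hA
  have := (hX {O | IsOpen O ∧ LocallyFineOn 𝒢 (A ∩ f ⁻¹' O)} (fun O hO => hO.1) ?_).inter_preimage
    hf (fun O hO => hO.2)
  · simpa using this
  · refine eq_univ_of_forall fun x => ?_
    by_cases hx : x ∈ residualSet f 𝒢 A
    · exact ⟨N, ⟨hN, h⟩, hAN hx⟩
    · simp only [residualSet, mem_ofPred_eq, not_forall, not_not] at hx
      obtain ⟨O, hO, hxO, h⟩ := hx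
      exact ⟨O, ⟨hO, h⟩, hxO⟩

theorem residualSet_nonempty (h𝒢 : ⋃₀ 𝒢 = univ) (hA : ¬ LocallyFineOn 𝒢 A) :
    (residualSet f 𝒢 A).Nonempty := by
  rw [nonempty_iff_ne_empty]
  intro h
  apply not_locallyFineOn_inter_preimage hX hf hA isOpen_empty h.subset
  simpa using locallyFineOn_empty h𝒢

theorem exists_residualSet_subset (h𝒢 : ⋃₀ 𝒢 = univ) (hA : ¬ LocallyFineOn 𝒢 A)
    {𝒰 : Set (Set X)} (h𝒰 : IsExhaustiveCover 𝒰) :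
    ∃ A' ⊆ A, ¬ LocallyFineOn 𝒢 A' ∧ ∃ U ∈ 𝒰, residualSet f 𝒢 A' ⊆ U := by
  obtain ⟨U, hU, ⟨x, hxU, hxS⟩, G, hG, hUG⟩ := h𝒰.2 _ (residualSet_nonempty hX hf h𝒢 hA)
  have hxG : x ∈ G := (hUG.subset ⟨hxU, hxS⟩).1
  -- A closed neighbourhood keeps the new residual set inside `G`, where `U` and the old residual
  -- set agree.
  obtain ⟨C, hC, hCclosed, hCG⟩ := exists_mem_nhds_isClosed_subset (hG.mem_nhds hxG)
  refine ⟨A ∩ f ⁻¹' interior C, inter_subset_left,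
    hxS _ isOpen_interior (mem_interior_iff_mem_nhds.2 hC), U, hU, fun y hy => ?_⟩
  have hyC : y ∈ C := by
    by_contra hyC
    refine hy _ hCclosed.isOpen_compl hyC ((locallyFineOn_empty h𝒢).mono ?_)
    rintro z ⟨⟨-, hz⟩, hz'⟩
    exact hz' ((interior_subset : interior C ⊆ C) hz)
  exact (hUG.superset ⟨hCG hyC, residualSet_mono inter_subset_left hy⟩).1

end

/-! ### Compactness from complete sequences -/

section

variable {X : Type*} [TopologicalSpace X] {𝒰 : ℕ → Set (Set X)} {S : ℕ → Set X}

theorem IsCompleteSequence.isCompact_iInter (h𝒰 : IsCompleteSequence 𝒰)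
    (hS : ∀ n, IsClosed (S n)) (hSU : ∀ k, ∃ n, ∃ U ∈ 𝒰 k, S n ⊆ U) :
    IsCompact (⋂ n, S n) := by
  intro F hF hFS
  rw [le_principal_iff] at hFS
  obtain ⟨x, hx⟩ := h𝒰 F hF fun k => by
    obtain ⟨n, U, hU, h⟩ := hSU k
    exact ⟨U, hU, mem_of_superset hFS ((iInter_subset _ n).trans h)⟩
  exact ⟨x, (isClosed_iInter hS).closure_eq.subset
    (mem_closure_iff_clusterPt.2 (hx.mono (le_principal_iff.2 hFS))), hx⟩

/-- If not, the closed sets `S n \ N` generate a proper filter, and a cluster point of it lies in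
all of them. -/
theorem IsCompleteSequence.exists_subset_of_iInter_subset (h𝒰 : IsCompleteSequence 𝒰)
    (hS : ∀ n, IsClosed (S n)) (hanti : Antitone S) (hSU : ∀ k, ∃ n, ∃ U ∈ 𝒰 k, S n ⊆ U)
    {N : Set X} (hN : IsOpen N) (hSN : ⋂ n, S n ⊆ N) : ∃ n, S n ⊆ N := by
  by_contra! hcon
  have hb : (⨅ n, 𝓟 (S n \ N)).HasBasis (fun _ => True) fun n => S n \ N :=
    hasBasis_iInf_principal (directed_of_isDirected_le fun _ _ h =>
      sdiff_subset_sdiff_left (hanti h))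
  have hmem : ∀ n, S n \ N ∈ ⨅ n, 𝓟 (S n \ N) := fun n => hb.mem_of_mem trivial
  obtain ⟨x, hx⟩ := h𝒰 _ (hb.neBot_iff.2 fun {n} _ => sdiff_nonempty.2 (hcon n)) fun k => by
    obtain ⟨n, U, hU, h⟩ := hSU k
    exact ⟨U, hU, mem_of_superset (hmem n) (sdiff_subset.trans h)⟩
  have hxS : ∀ n, x ∈ S n \ N := fun n =>
    ((hS n).sdiff hN).closure_eq.subset
      (mem_closure_iff_clusterPt.2 (hx.mono (le_principal_iff.2 (hmem n))))
  exact (hxS 0).2 (hSN (mem_iInter.2 fun n => (hxS n).1))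

end

/-- An open cover of a uniform space is locally fine on a uniform neighbourhood of each compact
set. -/
theorem exists_locallyFineOn_thickening {X : Type*} [UniformSpace X] {𝒢 : Set (Set X)}
    (hopen : ∀ G ∈ 𝒢, IsOpen G) (hcover : ⋃₀ 𝒢 = univ) {K : Set X} (hK : IsCompact K) :
    ∃ E ∈ 𝓤 X, LocallyFineOn 𝒢 {y | ∃ x ∈ K, (x, y) ∈ E} := by
  obtain ⟨V, hV, h⟩ := lebesgue_number_lemma_sUnion hK hopen (hcover ▸ subset_univ K)
  obtain ⟨D, hD, -, hDV⟩ := comp_symm_of_uniformity hV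
  obtain ⟨E, hE, hsymm, hED⟩ := comp_symm_of_uniformity hD
  refine ⟨E, hE, .of_ball hE fun y => ?_⟩
  rcases ({z | ∃ x ∈ K, (x, z) ∈ E} ∩ ball y E).eq_empty_or_nonempty with
    h0 | ⟨w, ⟨x, hx, hxw⟩, hyw⟩
  · exact h0 ▸ locallyFineOn_empty hcover
  · obtain ⟨G, hG, hxG⟩ := h x hx
    refine .of_subset hG fun z hz => hxG (hDV ⟨y, hED ⟨w, hxw, hsymm hyw⟩, hED ⟨y, ?_, hz.2⟩⟩)
    exact refl_mem_uniformity hE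

/-! ### Countable products -/

section

variable {ι : Type*} [Countable ι] {X : ι → Type*} [∀ i, UniformSpace (X i)]

theorem locallyFineOn_univ_pi
    (hX : ∀ i, ∀ 𝒪 : Set (Set (X i)), (∀ O ∈ 𝒪, IsOpen O) → ⋃₀ 𝒪 = univ → LocallyFineOn 𝒪 univ)
    (hpart : ∀ i, PartitionComplete (X i)) {𝒢 : Set (Set (∀ i, X i))}
    (hopen : ∀ G ∈ 𝒢, IsOpen G) (hcover : ⋃₀ 𝒢 = univ) : LocallyFineOn 𝒢 univ := by
  by_contra hbad
  choose 𝒰 h𝒰 hcomplete using hpart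
  have hproj : ∀ i, UniformContinuous fun x : ∀ i, X i => x i := Pi.uniformContinuous_proj X
  let R : ∀ i, Set (∀ i, X i) → Set (X i) := fun i A => residualSet (fun x => x i) 𝒢 A
  have : Encodable (ι × ℕ) := Encodable.ofCountable _
  have hnext : ∀ (n : ℕ) (A : {A : Set (∀ i, X i) // ¬ LocallyFineOn 𝒢 A}),
      ∃ A' : {A : Set (∀ i, X i) // ¬ LocallyFineOn 𝒢 A}, A'.1 ⊆ A.1 ∧
        ∀ p ∈ Encodable.decode (α := ι × ℕ) n, ∃ U ∈ 𝒰 p.1 p.2, R p.1 A'.1 ⊆ U := by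
    rintro n ⟨A, hA⟩
    rcases Encodable.decode (α := ι × ℕ) n with _ | p
    · exact ⟨⟨A, hA⟩, subset_rfl, by simp⟩
    · obtain ⟨A', hAA', hA', h⟩ := exists_residualSet_subset (hX p.1) (hproj p.1) hcover hA
        (h𝒰 p.1 p.2)
      exact ⟨⟨A', hA'⟩, hAA', by simpa using h⟩
  choose next hnext_subset hnext_residual using hnext
  let a : ℕ → {A : Set (∀ i, X i) // ¬ LocallyFineOn 𝒢 A} := fun n =>
    n.rec ⟨univ, hbad⟩ next
  have ha : Antitone fun n => (a n).1 := antitone_nat_of_succ_le fun n => hnext_subset n (a n)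
  -- The pair with code `n` is treated in passing from `a n` to `a (n + 1)`.
  have haU : ∀ i k, ∃ n, ∃ U ∈ 𝒰 i k, R i (a n).1 ⊆ U := fun i k =>
    ⟨Encodable.encode (i, k) + 1, hnext_residual _ (a _) (i, k) (Encodable.encodek (i, k))⟩
  have hRanti : ∀ i, Antitone fun n => R i (a n).1 := fun i _ _ h => residualSet_mono (ha h)
  have hRclosed : ∀ i n, IsClosed (R i (a n).1) := fun i n => isClosed_residualSet
  let K : ∀ i, Set (X i) := fun i => ⋂ n, R i (a n).1
  have hKcompact : ∀ i, IsCompact (K i) := fun i =>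
    (hcomplete i).isCompact_iInter (hRclosed i) (haU i)
  have hKN : ∀ i (N : Set (X i)), IsOpen N → K i ⊆ N → ∃ n, R i (a n).1 ⊆ N := fun i N hN h =>
    (hcomplete i).exists_subset_of_iInter_subset (hRclosed i) (hRanti i) (haU i) hN h
  have hKne : ∀ i, (K i).Nonempty := by
    intro i
    by_contra hemp
    obtain ⟨n, hn⟩ := hKN i ∅ isOpen_empty (not_nonempty_iff_eq_empty.1 hemp).subset
    obtain ⟨x, hx⟩ := residualSet_nonempty (hX i) (hproj i) hcover (a n).2
    exact hn hx
  choose k₀ hk₀ using hKne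
  obtain ⟨E, hE, hgood⟩ := exists_locallyFineOn_thickening hopen hcover
    (isCompact_univ_pi hKcompact)
  rw [Pi.uniformity, mem_iInf'] at hE
  obtain ⟨I, hI, V, hV, -, rfl, -⟩ := hE
  choose W hW hWV using fun i => mem_comap.1 (hV i)
  let N : ∀ i, Set (X i) := fun i => interior {y | ∃ x ∈ K i, (x, y) ∈ W i}
  have hN : ∀ i, K i ⊆ N i := fun i x hx => mem_interior_iff_mem_nhds.2 <|
    mem_of_superset (UniformSpace.ball_mem_nhds x (hW i)) fun y hy => ⟨x, hx, hy⟩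
  choose m hm using fun i => hKN i (N i) isOpen_interior (hN i)
  let n := hI.toFinset.sup m
  -- Each cut only shrinks the residual sets, so those in the remaining coordinates stay inside
  -- their `N i`.
  have hcut : ∀ t : Finset ι, t ⊆ hI.toFinset →
      ¬ LocallyFineOn 𝒢 ((a n).1 ∩ {x | ∀ i ∈ t, x i ∈ N i}) := by
    classical
    intro t
    induction t using Finset.induction_on with
    | empty => simpa using (a n).2
    | insert i t _ ih =>
      intro ht hgood'
      refine not_locallyFineOn_inter_preimage (hX i) (hproj i)
        (ih ((Finset.subset_insert i t).trans ht)) (N := N i) isOpen_interior ?_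
        (hgood'.mono ?_)
      · exact (residualSet_mono inter_subset_left).trans
          ((hRanti i (Finset.le_sup (ht (Finset.mem_insert_self i t)))).trans (hm i))
      · rintro x ⟨⟨hx, hxt⟩, hxi⟩
        exact ⟨hx, Finset.forall_mem_insert .. |>.2 ⟨hxi, hxt⟩⟩
  refine hcut _ subset_rfl (hgood.mono ?_)
  rintro y ⟨-, hy⟩
  have hy' : ∀ i, ∃ x ∈ K i, i ∈ I → (x, y i) ∈ W i := by
    intro i
    by_cases hi : i ∈ I
    · obtain ⟨x, hx, hxy⟩ := interior_subset (hy i (hI.mem_toFinset.2 hi))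
      exact ⟨x, hx, fun _ => hxy⟩
    · exact ⟨k₀ i, hk₀ i, fun h => absurd h hi⟩
  choose x hx hxy using hy'
  exact ⟨x, fun i _ => hx i, mem_iInter₂.2 fun i hi => hWV i (hxy i hi)⟩

end

/-! ### Paracompactness and the fine uniformity -/

/-- Every entourage contains the balls of a countably generated coarser uniformity. -/
theorem exists_isCountablyGenerated_uniformity {X : Type*} [u : UniformSpace X] {E : Set (X × X)}
    (hE : E ∈ 𝓤 X) :
    ∃ v : UniformSpace X, u ≤ v ∧ E ∈ 𝓤[v] ∧ IsCountablyGenerated 𝓤[v] := by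
  have hnext : ∀ V : {V : Set (X × X) // V ∈ 𝓤 X}, ∃ W : {W : Set (X × X) // W ∈ 𝓤 X},
      (∀ {a b}, (a, b) ∈ W.1 → (b, a) ∈ W.1) ∧ SetRel.comp W.1 W.1 ⊆ V.1 := by
    rintro ⟨V, hV⟩
    obtain ⟨W, hW, hs, hc⟩ := comp_symm_of_uniformity hV
    exact ⟨⟨W, hW⟩, hs, hc⟩
  choose next hsymm hcomp using hnext
  let V : ℕ → {V : Set (X × X) // V ∈ 𝓤 X} := fun n => n.rec ⟨E, hE⟩ fun _ => next
  have hV : Antitone fun n => (V n).1 := antitone_nat_of_succ_le fun n p hp =>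
    hcomp (V n) ⟨p.2, hp, refl_mem_uniformity (V (n + 1)).2⟩
  have hb : (⨅ n, 𝓟 (V n).1).HasBasis (fun _ => True) fun n => (V n).1 :=
    hasBasis_iInf_principal (directed_of_isDirected_le fun _ _ h => hV h)
  refine ⟨.ofCore
    { uniformity := ⨅ n, 𝓟 (V n).1
      refl := hb.ge_iff.2 fun n _ => refl_le_uniformity (V n).2
      symm := (hb.tendsto_iff hb).2 fun n _ => ⟨n + 1, trivial, fun p hp =>
        hV n.le_succ (hsymm (V n) hp)⟩
      comp := hb.ge_iff.2 fun n _ =>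
        mem_of_superset (mem_lift' (hb.mem_of_mem (i := n + 1) trivial)) (hcomp (V n)) },
    ?_, ?_, ?_⟩
  · exact hb.ge_iff.2 fun n _ => (V n).2
  · exact hb.mem_of_mem (i := 0) trivial
  · exact isCountablyGenerated_seq _

theorem paracompactSpace_of_isCountablyGenerated_uniformity {X : Type*} [UniformSpace X]
    [IsCountablyGenerated (𝓤 X)] : ParacompactSpace X :=
  letI := UniformSpace.pseudoMetricSpace X
  inferInstance

/-- The cover by balls of an entourage has a locally finite open refinement. -/
theorem exists_locallyFinite_subset_ball {X : Type*} [u : UniformSpace X] {E : Set (X × X)}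
    (hE : E ∈ 𝓤 X) : ∃ v : X → Set X, (∀ x, IsOpen (v x)) ∧ ⋃ x, v x = univ ∧ LocallyFinite v ∧
      ∀ x, v x ⊆ ball x E := by
  obtain ⟨u', huu', hE', hu'⟩ := exists_isCountablyGenerated_uniformity hE
  have hle := UniformSpace.toTopologicalSpace_mono huu'
  have := @paracompactSpace_of_isCountablyGenerated_uniformity X u' hu'
  obtain ⟨v, hv, hcover, hfin, hvE⟩ := @precise_refinement X X u'.toTopologicalSpace _
    (fun x => @interior X u'.toTopologicalSpace (ball x E)) (fun x => isOpen_interior)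
    (eq_univ_of_forall fun x => mem_iUnion.2 ⟨x, by
      rw [mem_interior_iff_mem_nhds]
      exact @UniformSpace.ball_mem_nhds X u' x E hE'⟩)
  refine ⟨v, fun x => hle _ (hv x), hcover, fun x => ?_, fun x => (hvE x).trans ?_⟩
  · obtain ⟨N, hN, h⟩ := hfin x
    exact ⟨N, nhds_mono hle hN, h⟩
  · exact @interior_subset X u'.toTopologicalSpace _

theorem LocallyFineOn.exists_locallyFinite.{v} {X : Type v} [UniformSpace X] {𝒢 : Set (Set X)}
    {A : Set X} (h : LocallyFineOn 𝒢 A) : ∃ (β : Type v) (t : β → Set X),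
      (∀ b, IsOpen (t b)) ∧ ⋃ b, t b = univ ∧ LocallyFinite t ∧ ∀ b, ∃ G ∈ 𝒢, A ∩ t b ⊆ G := by
  induction h with
  | of_subset hG hA =>
    exact ⟨PUnit, fun _ => univ, fun _ => isOpen_univ, iUnion_const _, locallyFinite_of_finite _,
      fun _ => ⟨_, hG, inter_subset_left.trans hA⟩⟩
  | @of_ball A E hE _ ih =>
    obtain ⟨v, hv, hvcover, hvfin, hvE⟩ := exists_locallyFinite_subset_ball hE
    choose β t ht htcover htfin htG using ih
    refine ⟨Σ x, β x, fun p => v p.1 ∩ t p.1 p.2, fun p => (hv _).inter (ht _ _),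
      eq_univ_of_forall fun z => ?_, fun z => ?_, fun ⟨x, b⟩ => ?_⟩
    · obtain ⟨x, hx⟩ := mem_iUnion.1 (hvcover.superset (mem_univ z))
      obtain ⟨b, hb⟩ := mem_iUnion.1 ((htcover x).superset (mem_univ z))
      exact mem_iUnion.2 ⟨⟨x, b⟩, hx, hb⟩
    · obtain ⟨N, hN, hNfin⟩ := hvfin z
      choose M hM hMfin using fun x => htfin x z
      refine ⟨N ∩ ⋂ x ∈ {x | (v x ∩ N).Nonempty}, M x,
        inter_mem hN ((biInter_mem hNfin).2 fun x _ => hM x),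
        (hNfin.biUnion fun x _ => (hMfin x).image (Sigma.mk x)).subset ?_⟩
      rintro ⟨x, b⟩ ⟨w, ⟨hwv, hwt⟩, hwN, hwM⟩
      have hx : (v x ∩ N).Nonempty := ⟨w, hwv, hwN⟩
      exact mem_biUnion hx ⟨b, ⟨w, hwt, mem_iInter₂.1 hwM x hx⟩, rfl⟩
    · obtain ⟨G, hG, hbG⟩ := htG x b
      exact ⟨G, hG, fun w hw => hbG ⟨⟨hw.1, hvE x hw.2.1⟩, hw.2.2⟩⟩

theorem paracompactSpace_of_locallyFineOn {X : Type*} [UniformSpace X]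
    (hX : ∀ 𝒢 : Set (Set X), (∀ G ∈ 𝒢, IsOpen G) → ⋃₀ 𝒢 = univ → LocallyFineOn 𝒢 univ) :
    ParacompactSpace X := by
  refine ⟨fun α s hs hcover => ?_⟩
  obtain ⟨β, t, ht, htcover, htfin, h⟩ :=
    (hX (range s) (forall_mem_range.2 hs) (by rwa [sUnion_range])).exists_locallyFinite
  refine ⟨β, t, ht, htcover, htfin, fun b => ?_⟩
  obtain ⟨_, ⟨a, rfl⟩, ha⟩ := h b
  exact ⟨a, by simpa using ha⟩

/-- Open covers of paracompact regular spaces have open barycentric refinements. -/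
theorem exists_barycentric_refinement {X : Type*} [TopologicalSpace X] [RegularSpace X]
    [ParacompactSpace X] {𝒢 : Set (Set X)} (hopen : ∀ G ∈ 𝒢, IsOpen G) (hcover : ⋃₀ 𝒢 = univ) :
    ∃ W : X → Set X, (∀ x, IsOpen (W x) ∧ x ∈ W x) ∧
      ∀ z, ∃ G ∈ 𝒢, ∀ x, z ∈ W x → W x ⊆ G := by
  have hG : ∀ x, ∃ G ∈ 𝒢, ∃ C ∈ 𝓝 x, IsClosed C ∧ C ⊆ G := by
    intro x
    obtain ⟨G, hG, hx⟩ : x ∈ ⋃₀ 𝒢 := hcover ▸ mem_univ x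
    exact ⟨G, hG, exists_mem_nhds_isClosed_subset ((hopen G hG).mem_nhds hx)⟩
  choose G hG𝒢 C hC hCclosed hCG using hG
  obtain ⟨v, -, hvcover, hvfin, hvC⟩ := precise_refinement (fun x => interior (C x))
    (fun _ => isOpen_interior)
    (eq_univ_of_forall fun x => mem_iUnion.2 ⟨x, mem_interior_iff_mem_nhds.2 (hC x)⟩)
  have hvG : ∀ i, closure (v i) ⊆ G i := fun i =>
    (closure_minimal ((hvC i).trans interior_subset) (hCclosed i)).trans (hCG i)
  have hfin := hvfin.closure
  -- If `z ∈ v i` and `z ∈ W x`, then `x ∈ closure (v i)`, so `W x ⊆ G i` with `i` depending on `z`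
  -- alone.
  refine ⟨fun x => (⋂ i ∈ {i | x ∈ closure (v i)}, G i) ∩
    (⋃ i : {i // x ∉ closure (v i)}, closure (v i))ᶜ, fun x => ⟨?_, ?_, ?_⟩, fun z => ?_⟩
  · exact ((hfin.point_finite x).isOpen_biInter fun i _ => hopen _ (hG𝒢 i)).inter
      ((hfin.comp_injective Subtype.val_injective).isClosed_iUnion
        fun _ => isClosed_closure).isOpen_compl
  · exact mem_iInter₂.2 fun i hi => hvG i hi
  · simp
  · obtain ⟨i, hi⟩ := mem_iUnion.1 (hvcover.superset (mem_univ z))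
    refine ⟨G i, hG𝒢 i, fun x hzx => ?_⟩
    have hxi : x ∈ closure (v i) := by
      by_contra hxi
      exact hzx.2 (mem_iUnion.2 ⟨⟨i, hxi⟩, subset_closure hi⟩)
    exact inter_subset_left.trans (biInter_subset_of_mem hxi)

theorem iUnion_prod_self_mem_nhdsSet_diagonal {X : Type*} [TopologicalSpace X] {W : X → Set X}
    (hW : ∀ x, IsOpen (W x) ∧ x ∈ W x) : (⋃ x, W x ×ˢ W x) ∈ 𝓝ˢ (diagonal X) :=
  (isOpen_iUnion fun x => (hW x).1.prod (hW x).1).mem_nhdsSet.2 fun ⟨x, y⟩ hxy =>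
    mem_iUnion.2 ⟨x, (hW x).2, (show x = y from hxy) ▸ (hW x).2⟩

/-- The uniformity of all neighbourhoods of the diagonal of a paracompact regular space. -/
@[reducible]
def diagonalUniformSpace (X : Type*) [TopologicalSpace X] [RegularSpace X] [ParacompactSpace X] :
    UniformSpace X := .ofCore
  { uniformity := 𝓝ˢ (diagonal X)
    refl := by
      rintro N hN ⟨x, y⟩ hxy
      exact subset_of_mem_nhdsSet hN hxy
    symm := continuous_swap.tendsto_nhdsSet fun _ => Eq.symm
    comp := by
      intro N hN
      obtain ⟨W, hW, hWN⟩ := exists_barycentric_refinement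
        (𝒢 := {O : Set X | IsOpen O ∧ O ×ˢ O ⊆ N}) (fun O hO => hO.1)
        (eq_univ_of_forall fun x => by
          have hx : N ∈ 𝓝 (x, x) := nhds_le_nhdsSet (mem_diagonal x) hN
          obtain ⟨U, V, hU, hxU, hV, hxV, h⟩ := mem_nhds_prod_iff'.1 hx
          exact ⟨U ∩ V, ⟨hU.inter hV, (prod_mono inter_subset_left inter_subset_right).trans h⟩,
            hxU, hxV⟩)
      refine mem_of_superset (mem_lift' (iUnion_prod_self_mem_nhdsSet_diagonal hW)) ?_
      rintro ⟨y, w⟩ ⟨z, hyz, hzw⟩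
      obtain ⟨x, hy, hz⟩ := mem_iUnion.1 hyz
      obtain ⟨x', hz', hw⟩ := mem_iUnion.1 hzw
      obtain ⟨O, hO, h⟩ := hWN z
      exact hO.2 ⟨h x hz hy, h x' hz' hw⟩ }

section

variable {X : Type*} [u : UniformSpace X]

theorem fineUniformity_le : fineUniformity X ≤ u :=
  sInf_le rfl

theorem toTopologicalSpace_fineUniformity :
    (fineUniformity X).toTopologicalSpace = u.toTopologicalSpace := by
  refine le_antisymm (UniformSpace.toTopologicalSpace_mono fineUniformity_le) ?_
  rw [UniformSpace.toTopologicalSpace_sInf]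
  exact le_iInf₂ fun v hv => hv.ge

theorem fineUniformity_le_diagonalUniformSpace [ParacompactSpace X] :
    fineUniformity X ≤ diagonalUniformSpace X := by
  -- It suffices that the diagonal uniformity induces no finer topology: its infimum with `u` then
  -- induces the given one.
  refine (sInf_le ?_ : fineUniformity X ≤ u ⊓ diagonalUniformSpace X).trans inf_le_right
  rw [mem_ofPred_eq, UniformSpace.toTopologicalSpace_inf, inf_eq_left]
  refine le_of_nhds_le_nhds fun x => ?_
  rw [@nhds_eq_comap_uniformity X (diagonalUniformSpace X), ← tendsto_iff_comap]
  refine Tendsto.mono_right ?_ (nhds_le_nhdsSet (mem_diagonal x))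
  exact (Continuous.prodMk_right x).tendsto x

/-- In a paracompact uniformizable space the fine uniform covers are the covers refined by an open
cover. -/
theorem mem_uniformCovers_fineUniformity [ParacompactSpace X] {𝒲 : Set (Set X)} :
    𝒲 ∈ (uniformCovers (fineUniformity X)).covers ↔ ∀ x, ∃ W ∈ 𝒲, W ∈ 𝓝 x := by
  constructor
  · rintro ⟨E, hE, h⟩ x
    obtain ⟨W, hW, hxW⟩ := h x
    have := @UniformSpace.ball_mem_nhds X (fineUniformity X) x E hE
    rw [toTopologicalSpace_fineUniformity] at this
    exact ⟨W, hW, mem_of_superset this hxW⟩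
  · intro h
    obtain ⟨W, hW, hW𝒲⟩ := exists_barycentric_refinement (𝒢 := interior '' 𝒲)
      (forall_mem_image.2 fun _ _ => isOpen_interior) (eq_univ_of_forall fun x => by
        obtain ⟨W, hW, hx⟩ := h x
        exact ⟨_, mem_image_of_mem _ hW, mem_interior_iff_mem_nhds.2 hx⟩)
    refine ⟨_, fineUniformity_le_diagonalUniformSpace (iUnion_prod_self_mem_nhdsSet_diagonal hW),
      fun x => ?_⟩
    obtain ⟨_, ⟨V, hV, rfl⟩, h⟩ := hW𝒲 x
    refine ⟨V, hV, fun y hy => ?_⟩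
    obtain ⟨z, hx, hy⟩ := mem_iUnion.1 hy
    exact interior_subset (h z hx hy)

theorem locallyFine_eq_uniformCovers_fineUniformity
    (hX : ∀ 𝒢 : Set (Set X), (∀ G ∈ 𝒢, IsOpen G) → ⋃₀ 𝒢 = univ → LocallyFineOn 𝒢 univ) :
    (uniformCovers u).locallyFine = uniformCovers (fineUniformity X) := by
  have := paracompactSpace_of_locallyFineOn hX
  refine PreUniformity.ext (Subset.antisymm (fun 𝒲 h𝒲 => h𝒲 _ ?_ ?_) fun 𝒲 h𝒲 => ?_)
  · rintro 𝒰 ⟨E, hE, h⟩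
    exact ⟨E, fineUniformity_le (X := X) hE, h⟩
  · rintro 𝒲 ⟨𝒰, h𝒰, 𝒱, h𝒱, hr⟩
    refine mem_uniformCovers_fineUniformity.2 fun x => ?_
    obtain ⟨U, hU, hxU⟩ := mem_uniformCovers_fineUniformity.1 h𝒰 x
    obtain ⟨V, hV, hxV⟩ := mem_uniformCovers_fineUniformity.1 (h𝒱 U hU) x
    obtain ⟨W, hW, hUV⟩ := hr _ ⟨U, hU, V, hV, rfl⟩
    exact ⟨W, hW, mem_of_superset (inter_mem hxU hxV) hUV⟩
  · refine (uniformCovers u).locallyFine.mem_of_refines _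
      (hX (interior '' 𝒲) (forall_mem_image.2 fun _ _ => isOpen_interior) ?_).mem_locallyFine _
      (forall_mem_image.2 fun W hW => ⟨W, hW, interior_subset⟩)
    refine eq_univ_of_forall fun x => ?_
    obtain ⟨W, hW, hx⟩ := mem_uniformCovers_fineUniformity.1 h𝒲 x
    exact ⟨_, mem_image_of_mem _ hW, mem_interior_iff_mem_nhds.2 hx⟩

end

end Supercompleteness

theorem corollary6p3 {ι : Type*} [Countable ι] (X : ι → Type*) [∀ i, UniformSpace (X i)]
    (hsuper : ∀ i, Supercompleteness.Supercomplete (X i))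
    (hpart : ∀ i, Supercompleteness.PartitionComplete (X i)) :
    Supercompleteness.Supercomplete (∀ i, X i) ∧
    (∀ 𝒢 : Set (Set (∀ i, X i)), (∀ G ∈ 𝒢, IsOpen G) → ⋃₀ 𝒢 = Set.univ →
      𝒢 ∈ (Supercompleteness.uniformCovers
        (Pi.uniformSpace X)).locallyFine.covers) ∧
    (Supercompleteness.uniformCovers (Pi.uniformSpace X)).locallyFine =
      Supercompleteness.uniformCovers
        (Supercompleteness.fineUniformity (∀ i, X i)) := by
  have h : ∀ 𝒢 : Set (Set (∀ i, X i)), (∀ G ∈ 𝒢, IsOpen G) → ⋃₀ 𝒢 = Set.univ →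
      Supercompleteness.LocallyFineOn 𝒢 Set.univ := fun _ hopen hcover =>
    Supercompleteness.locallyFineOn_univ_pi
      (fun i _ hO h => (hsuper i).locallyFineOn_univ hO h) hpart hopen hcover
  exact ⟨Supercompleteness.supercomplete_of_locallyFineOn h,
    fun 𝒢 hopen hcover => (h 𝒢 hopen hcover).mem_locallyFine,
    Supercompleteness.locallyFine_eq_uniformCovers_fineUniformity h⟩
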